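/- Let $m,N\ge 1$ be integers, let $\mathbb M^{m\times N}$ be the space of real $m\times N$ matrices, let $Y=\,]0,1[^N$, and let $W:\mathbb M^{m\times N}\to[0,+\infty]$ be Borel measurable. Let $W^{1,\infty}_0(Y;\mathbb R^m)$ be the set of all $\varphi\in W^{1,\infty}(Y;\mathbb R^m)$ whose continuous representative on $\overline Y$ vanishes on $\partial Y$, and let $\mathrm{Aff}_0(Y;\mathbb R^m)$ be the set of all continuous functions $\varphi:\overline Y\to\mathbb R^m$ that vanish on $\partial Y$ and are piecewise affine, i.e. affine on each of finitely many pairwise disjoint open subsets of $Y$ whose union has full measure in $Y$. For $F\in\mathbb M^{m\times N}$ put $$\mathcal Z_\infty W(F):=\inf\Big\{\int_Y W(F+\nabla\varphi(y))\,dy:\ \varphi\in W^{1,\infty}_0(Y;\mathbb R^m)\Big\},\qquad \mathcal Z W(F):=\inf\Big\{\int_Y W(F+\nabla\varphi(y))\,dy:\ \varphi\in \mathrm{Aff}_0(Y;\mathbb R^m)\Big\}.$$ A function $V:\mathbb M^{m\times N}\to[0,+\infty]$ is called quasiconvex if it is Borel measurable and $V(F)\le\int_Y V(F+\nabla\varphi(y))\,dy$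 for all $F\in\mathbb M^{m\times N}$ and all $\varphi\in W^{1,\infty}_0(Y;\mathbb R^m)$. It is called rank-one convex if $V(sA+tB)\le sV(A)+tV(B)$ (with $0\cdot\infty=0$) whenever $A,B\in\mathbb M^{m\times N}$, $\operatorname{rank}(A-B)\le 1$, $s,t\ge 0$ and $s+t=1$. For any $f:\mathbb M^{m\times N}\to[0,+\infty]$, the quasiconvex envelope $\mathcal Q f$ (resp. the rank-one convex envelope $\mathcal R f$) is the pointwise supremum of all quasiconvex (resp. rank-one convex) functions $V:\mathbb M^{m\times N}\to[0,+\infty]$ with $V\le f$. If $\mathcal Z_\infty W(F)<+\infty$ for all $F\in\mathbb M^{m\times N}$, or $\mathcal Z W(F)<+\infty$ for all $F\in\mathbb M^{m\times N}$, then $$\mathcal Q(\mathcal R W)=\mathcal Q W .$$ -/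

import Mathlib

open MeasureTheory Set
open scoped ENNReal NNReal ContDiff

noncomputable section

namespace QuasiconvexEnvelope

/-- Points of `ℝ^n`. Only the Lebesgue measure, the topology and the linear structure of `ℝ^n` are
used below, and these do not depend on the choice of a norm. -/
abbrev Vec (n : ℕ) : Type := Fin n → ℝ

/-- The space of real `m × N` matrices (with its Borel sigma-algebra). -/
abbrev Mat (m N : ℕ) : Type := Matrix (Fin m) (Fin N) ℝ

instance instMeasurableSpaceMat (m N : ℕ) : MeasurableSpace (Mat m N) := borel (Mat m N)

instance instBorelSpaceMat (m N : ℕ) : BorelSpace (Mat m N) := ⟨rfl⟩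

/-- The open unit cube `Y = ]0,1[^N`. -/
def unitCube (N : ℕ) : Set (Vec N) := Set.pi Set.univ fun _ => Set.Ioo (0 : ℝ) 1

/-- `φ` belongs to `W^{1,∞}(Y; ℝ^m)` with weak gradient `G`: both are essentially bounded (and
measurable) on `Y`, and `∫_Y φ_i ∂_j ψ = - ∫_Y G_{ij} ψ` for every test function `ψ ∈ C_c^∞(Y)`. -/
structure IsSobolevOneInfty {m N : ℕ} (φ : Vec N → Vec m) (G : Vec N → Mat m N) : Prop where
  memLp : ∀ i, MemLp (fun y => φ y i) ∞ (volume.restrict (unitCube N))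
  memLp_grad : ∀ i j, MemLp (fun y => G y i j) ∞ (volume.restrict (unitCube N))
  integral_eq : ∀ (i : Fin m) (j : Fin N) (ψ : Vec N → ℝ),
    ContDiff ℝ ∞ ψ → HasCompactSupport ψ → tsupport ψ ⊆ unitCube N →
      ∫ y in unitCube N, φ y i * fderiv ℝ ψ y (Pi.single j 1)
        = - ∫ y in unitCube N, G y i j * ψ y

/-- `φ` belongs to `W^{1,∞}_0(Y; ℝ^m)` with weak gradient `G`. Elements of `W^{1,∞}(Y; ℝ^m)` are
represented by their continuous representative on the closed cube, which vanishes on `∂Y`. -/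
structure IsSobolevOneInftyZero {m N : ℕ} (φ : Vec N → Vec m) (G : Vec N → Mat m N) : Prop
    extends IsSobolevOneInfty φ G where
  continuousOn : ContinuousOn φ (closure (unitCube N))
  eq_zero : ∀ y ∈ frontier (unitCube N), φ y = 0

/-- `φ` belongs to `Aff_0(Y; ℝ^m)`: it is continuous on the closed cube, vanishes on `∂Y`, and is
affine on each of finitely many disjoint open subsets of `Y` that cover `Y` up to a null set. -/
structure IsPiecewiseAffineZero {m N : ℕ} (φ : Vec N → Vec m) : Prop where
  continuousOn : ContinuousOn φ (closure (unitCube N))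
  exists_pieces : ∃ (k : ℕ) (V : Fin k → Set (Vec N)),
    (∀ l, IsOpen (V l)) ∧ (∀ l, V l ⊆ unitCube N) ∧ Pairwise (Function.onFun Disjoint V) ∧
      volume (unitCube N \ ⋃ l, V l) = 0 ∧
      ∀ l, ∃ (A : Mat m N) (c : Vec m), ∀ y ∈ V l, φ y = A.mulVec y + c
  eq_zero : ∀ y ∈ frontier (unitCube N), φ y = 0

/-- The (classical) gradient matrix `∇φ(y) = (∂_j φ_i(y))_{ij}`; for a piecewise affine `φ` it
exists at almost every point of `Y`. -/
def gradMatrix {m N : ℕ} (φ : Vec N → Vec m) (y : Vec N) : Mat m N :=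
  Matrix.of fun i j => fderiv ℝ φ y (Pi.single j 1) i

/-- `𝒵_∞ W (F) = inf { ∫_Y W (F + ∇φ) : φ ∈ W^{1,∞}_0(Y; ℝ^m) }`; the weak gradient `G = ∇φ` is
determined by `φ` almost everywhere in `Y`. -/
def zInfty {m N : ℕ} (W : Mat m N → ℝ≥0∞) (F : Mat m N) : ℝ≥0∞ :=
  ⨅ (φ : Vec N → Vec m) (G : Vec N → Mat m N) (_ : IsSobolevOneInftyZero φ G),
    ∫⁻ y in unitCube N, W (F + G y)

/-- `𝒵 W (F) = inf { ∫_Y W (F + ∇φ) : φ ∈ Aff_0(Y; ℝ^m) }`. -/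
def zAff {m N : ℕ} (W : Mat m N → ℝ≥0∞) (F : Mat m N) : ℝ≥0∞ :=
  ⨅ (φ : Vec N → Vec m) (_ : IsPiecewiseAffineZero φ),
    ∫⁻ y in unitCube N, W (F + gradMatrix φ y)

/-- Quasiconvexity of a `[0,∞]`-valued function in the sense of Morrey: `V` is Borel measurable and
`V(F) ≤ ∫_Y V (F + ∇φ)` for every matrix `F` and every `φ ∈ W^{1,∞}_0(Y; ℝ^m)`. -/
structure IsQuasiconvex {m N : ℕ} (V : Mat m N → ℝ≥0∞) : Prop where
  measurable : Measurable V
  le_lintegral : ∀ (F : Mat m N) (φ : Vec N → Vec m) (G : Vec N → Mat m N),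
    IsSobolevOneInftyZero φ G → V F ≤ ∫⁻ y in unitCube N, V (F + G y)

/-- The quasiconvex envelope `𝒬 W = sup { V : V quasiconvex, V ≤ W }`. -/
def quasiconvexEnvelope {m N : ℕ} (W : Mat m N → ℝ≥0∞) (F : Mat m N) : ℝ≥0∞ :=
  ⨆ (V : Mat m N → ℝ≥0∞) (_ : IsQuasiconvex V) (_ : ∀ F', V F' ≤ W F'), V F

/-- Rank-one convexity of a `[0,∞]`-valued function: convexity along every segment whose end points
differ by a matrix of rank at most one (with the convention `0 · ∞ = 0`). -/
def IsRankOneConvex {m N : ℕ} (V : Mat m N → ℝ≥0∞) : Prop :=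
  ∀ A B : Mat m N, (A - B).rank ≤ 1 → ∀ s t : ℝ≥0, s + t = 1 →
    V ((s : ℝ) • A + (t : ℝ) • B) ≤ (s : ℝ≥0∞) * V A + (t : ℝ≥0∞) * V B

/-- The rank-one convex envelope `ℛ W = sup { V : V rank-one convex, V ≤ W }`. -/
def rankOneConvexEnvelope {m N : ℕ} (W : Mat m N → ℝ≥0∞) (F : Mat m N) : ℝ≥0∞ :=
  ⨆ (V : Mat m N → ℝ≥0∞) (_ : IsRankOneConvex V) (_ : ∀ F', V F' ≤ W F'), V F

end QuasiconvexEnvelope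

end

namespace QuasiconvexEnvelope

open Filter Topology

/-! One inequality holds because `ℛ W ≤ W`. For the other, every quasiconvex `V ≤ W` must be shown
to lie below `ℛ W`. Testing gives `V ≤ 𝒵_∞ W` and `V ≤ 𝒵 W`, so `V` is finite everywhere. It then
suffices that a finite quasiconvex function is rank-one convex (`IsQuasiconvex.isRankOneConvex`).

No continuity of `V` is needed. With `A - B = a ⊗ n` and `F = sA + tB`, the test function is `a`
times a fine sawtooth in direction `n` with random phase `θ`, truncated by the sup-norm distance to
`∂Y`. By `fderiv_laminate`, `F + ∇φ` is almost everywhere `A`, `B` or `F` outside the truncation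
zone, and `F ± a ⊗ e_i` inside it. Averaging over `θ` at fixed `y` gives weights exactly `s` and `t`
(`lintegral_phase_le`). The zone contributes at most a finite constant times the measure of a
vanishing boundary layer. -/

/-! ### Rank-one matrices and two calculus tools -/

lemma exists_eq_mul_of_rank_le_one {m N : ℕ} {C : Mat m N} (hC : C.rank ≤ 1) :
    ∃ (a : Vec m) (n : Vec N), ∀ i j, C i j = a i * n j := by
  obtain ⟨a, ha⟩ := finrank_le_one_iff.1 hC
  choose c hc using fun j : Fin N =>
    ha ⟨C.mulVecLin (Pi.single j 1), LinearMap.mem_range_self _ _⟩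
  refine ⟨a, c, fun i j => ?_⟩
  have h := congrFun (congrArg Subtype.val (hc j)) i
  simp only [Matrix.mulVecLin_apply, Matrix.mulVec_single_one] at h
  simp only [Submodule.coe_smul, Pi.smul_apply, smul_eq_mul, Matrix.col_apply] at h
  rw [← h, mul_comm]

/-- Along a segment, `‖g - g x‖` has right slopes at most `K * ‖y - x‖`, so the one-sided mean value
inequality applies. The bound at each point may hold on a neighbourhood of uncontrolled size. -/
lemma _root_.Convex.lipschitzOnWith_of_eventually {E F : Type*} [NormedAddCommGroup E]
    [NormedSpace ℝ E] [NormedAddCommGroup F] {S : Set E} (hS : Convex ℝ S) {g : E → F} {K : ℝ≥0}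
    (hg : ContinuousOn g S)
    (hloc : ∀ x ∈ S, ∀ᶠ z in 𝓝[S] x, ‖g z - g x‖ ≤ K * ‖z - x‖) : LipschitzOnWith K g S := by
  refine LipschitzOnWith.of_dist_le_mul fun y hy x hx => ?_
  rw [dist_eq_norm, dist_eq_norm]
  have hγ : Continuous fun τ : ℝ => AffineMap.lineMap x y τ := AffineMap.lineMap_continuous
  have hmaps : MapsTo (fun τ : ℝ => AffineMap.lineMap x y τ) (Icc 0 1) S := fun τ hτ =>
    hS.lineMap_mem hx hy hτ
  have key := image_le_of_liminf_slope_right_le_deriv_boundary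
    (f := fun τ : ℝ => ‖g (AffineMap.lineMap x y τ) - g x‖) (a := 0) (b := 1)
    (B := fun τ => K * ‖y - x‖ * τ) (B' := fun _ => K * ‖y - x‖)
    (((hg.comp hγ.continuousOn hmaps).sub continuousOn_const).norm) (by simp) (by fun_prop)
    (fun τ _ => by simpa using ((hasDerivWithinAt_id τ (Ici τ)).const_mul (K * ‖y - x‖)))
    (fun τ hτ r hr => by
      have hev : ∀ᶠ z in 𝓝[>] τ, z ∈ Icc (0 : ℝ) 1 := by
        filter_upwards [Ioo_mem_nhdsGT hτ.2] with z hz using ⟨hτ.1.trans hz.1.le, hz.2.le⟩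
      have ht : Tendsto (fun τ : ℝ => AffineMap.lineMap x y τ) (𝓝[>] τ)
          (𝓝[S] (AffineMap.lineMap x y τ)) :=
        tendsto_nhdsWithin_iff.2 ⟨hγ.continuousAt.mono_left nhdsWithin_le_nhds,
          hev.mono fun z hz => hmaps hz⟩
      have h1 := ht.eventually (hloc _ (hmaps ⟨hτ.1, hτ.2.le⟩))
      refine Eventually.frequently ?_
      filter_upwards [h1, self_mem_nhdsWithin] with z hz hzτ
      have hzτ' : 0 < z - τ := sub_pos.2 hzτ
      refine lt_of_le_of_lt ?_ hr
      rw [slope_def_field, div_le_iff₀ hzτ']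
      have h2 : (AffineMap.lineMap x y z : E) - AffineMap.lineMap x y τ = (z - τ) • (y - x) := by
        simp only [AffineMap.lineMap_apply_module']
        module
      rw [h2, norm_smul, Real.norm_of_nonneg hzτ'.le] at hz
      have h3 := norm_sub_norm_le (g (AffineMap.lineMap x y z) - g x)
        (g (AffineMap.lineMap x y τ) - g x)
      rw [sub_sub_sub_cancel_right] at h3
      nlinarith)
  simpa using key (right_mem_Icc.2 zero_le_one)

/-- The difference `g - f` has a local minimum at `y`. This reads off gradients of minima of
functions without case analysis near the kinks. -/
lemma fderiv_eq_of_touching {E : Type*} [NormedAddCommGroup E] [NormedSpace ℝ E] {f g : E → ℝ}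
    {L : E →L[ℝ] ℝ} {y : E} (hf : DifferentiableAt ℝ f y) (hg : HasFDerivAt g L y)
    (hle : ∀ᶠ z in 𝓝 y, f z ≤ g z) (heq : f y = g y) : fderiv ℝ f y = L := by
  have hmin : IsLocalMin (fun z => g z - f z) y := by
    filter_upwards [hle] with z hz
    simpa [heq] using hz
  have := hmin.hasFDerivAt_eq_zero (hg.sub hf.hasFDerivAt)
  exact (sub_eq_zero.1 this).symm

/-! ### Lipschitz and piecewise affine test functions on the cube -/

lemma unitCube_eq_ball (N : ℕ) : unitCube N = Metric.ball (fun _ => (1 / 2 : ℝ)) (1 / 2) := by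
  rw [ball_pi _ (by norm_num)]
  simp only [unitCube, Real.ball_eq_Ioo]
  norm_num

lemma isOpen_unitCube (N : ℕ) : IsOpen (unitCube N) := by
  rw [unitCube_eq_ball]; exact Metric.isOpen_ball

lemma convex_closure_unitCube (N : ℕ) : Convex ℝ (closure (unitCube N)) := by
  rw [unitCube_eq_ball]; exact (convex_ball _ _).closure

lemma isCompact_closure_unitCube (N : ℕ) : IsCompact (closure (unitCube N)) := by
  rw [unitCube_eq_ball]; exact Metric.isBounded_ball.isCompact_closure

lemma volume_unitCube (N : ℕ) : volume (unitCube N) = 1 := by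
  simp [unitCube, Real.volume_pi_Ioo]

/-- Extend `φ` to a Lipschitz map of the whole space. Rademacher's theorem and integration by parts
apply there, and the support of `ψ` confines both integrals to the cube. -/
lemma isSobolevOneInftyZero_gradMatrix {m N : ℕ} {φ : Vec N → Vec m} {K : ℝ≥0}
    (hφ : LipschitzOnWith K φ (closure (unitCube N)))
    (h0 : ∀ y ∈ frontier (unitCube N), φ y = 0) :
    IsSobolevOneInftyZero φ (gradMatrix φ) := by
  have hopen := isOpen_unitCube N
  have hmeas := hopen.measurableSet
  have hcomp (i : Fin m) : ContinuousOn (fun y => φ y i) (closure (unitCube N)) :=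
    (continuous_apply i).comp_continuousOn hφ.continuousOn
  refine ⟨⟨fun i => ?_, fun i j => ?_, fun i j ψ hψ hcs hsupp => ?_⟩, hφ.continuousOn, h0⟩
  · obtain ⟨C, hC⟩ := (isCompact_closure_unitCube N).exists_bound_of_continuousOn (hcomp i)
    refine memLp_top_of_bound
      (((hcomp i).mono subset_closure).aestronglyMeasurable hmeas) C ?_
    filter_upwards [ae_restrict_mem hmeas] with y hy using hC y (subset_closure hy)
  · refine memLp_top_of_bound ?_ (K : ℝ) ?_
    · exact ((measurable_pi_apply i).comp
        (measurable_fderiv_apply_const ℝ φ (Pi.single j 1))).aestronglyMeasurable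
    · filter_upwards [ae_restrict_mem hmeas] with y hy
      have h1 := norm_fderiv_le_of_lipschitzOn ℝ
        (mem_of_superset (hopen.mem_nhds hy) subset_closure) hφ
      have h2 := (fderiv ℝ φ y).le_opNorm (Pi.single j 1)
      rw [Pi.norm_single, norm_one, mul_one] at h2
      exact (norm_le_pi_norm (fderiv ℝ φ y (Pi.single j 1)) i).trans (h2.trans h1)
  · obtain ⟨Φ, hΦ, hΦeq⟩ := hφ.extend_pi
    have hΦi : LipschitzWith K fun y => Φ y i := LipschitzWith.of_dist_le_mul fun x y =>
      (dist_le_pi_dist (Φ x) (Φ y) i).trans (hΦ.dist_le_mul x y)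
    obtain ⟨D, hD⟩ := ContDiff.lipschitzWith_of_hasCompactSupport hcs hψ (by simp)
    have key := hΦi.integral_lineDeriv_mul_eq (μ := volume) hD hcs (Pi.single j 1)
    have hψd : Differentiable ℝ ψ := hψ.differentiable (by simp)
    have hL : ∫ y in unitCube N, φ y i * fderiv ℝ ψ y (Pi.single j 1)
        = - ∫ y, lineDeriv ℝ ψ y (-Pi.single j 1) * Φ y i := by
      rw [← integral_neg]
      refine (setIntegral_congr_fun hmeas fun y hy => ?_).trans
        (setIntegral_eq_integral_of_forall_compl_eq_zero fun y hy => ?_)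
      · rw [(hψd y).lineDeriv_eq_fderiv, map_neg, hΦeq (subset_closure hy)]
        ring
      · have h : y ∉ tsupport (fderiv ℝ ψ) :=
          notMem_subset (tsupport_fderiv_subset ℝ) (notMem_subset hsupp hy)
        rw [(hψd y).lineDeriv_eq_fderiv, image_eq_zero_of_notMem_tsupport h]
        simp
    have hR : ∫ y in unitCube N, gradMatrix φ y i j * ψ y
        = ∫ y, lineDeriv ℝ (fun y => Φ y i) y (Pi.single j 1) * ψ y := by
      refine (setIntegral_congr_ae hmeas ?_).trans
        (setIntegral_eq_integral_of_forall_compl_eq_zero fun y hy => ?_)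
      · filter_upwards [hΦ.ae_differentiableAt (μ := volume)] with y hy hyY
        congr 1
        have h1 : fderiv ℝ φ y = fderiv ℝ Φ y := EventuallyEq.fderiv_eq <| by
          filter_upwards [hopen.mem_nhds hyY] with z hz using hΦeq (subset_closure hz)
        have h2 := (hasFDerivAt_pi'.1 hy.hasFDerivAt i)
        rw [h2.differentiableAt.lineDeriv_eq_fderiv, h2.fderiv]
        simp [gradMatrix, h1]
      · rw [image_eq_zero_of_notMem_tsupport (notMem_subset hsupp hy), mul_zero]
    rw [hL, hR, key]

/-- The closures of the pieces cover the closed cube, and each affine formula persists on the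
closure. This gives the local slope bound, which convexity makes global. -/
lemma IsPiecewiseAffineZero.exists_lipschitzOnWith {m N : ℕ} {φ : Vec N → Vec m}
    (hφ : IsPiecewiseAffineZero φ) : ∃ K, LipschitzOnWith K φ (closure (unitCube N)) := by
  obtain ⟨k, V, -, hV, -, hvol, haff⟩ := hφ.exists_pieces
  choose A c hAc using haff
  let K : ℝ≥0 := ∑ l, ‖(Matrix.mulVecLin (A l)).toContinuousLinearMap‖₊
  have hdense : closure (unitCube N) ⊆ ⋃ l, closure (V l) := by
    rw [← closure_iUnion_of_finite]
    refine closure_minimal (fun y hy => ?_) isClosed_closure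
    by_contra hyc
    have hO : IsOpen (unitCube N \ closure (⋃ l, V l)) :=
      (isOpen_unitCube N).sdiff isClosed_closure
    have h0 : volume (unitCube N \ closure (⋃ l, V l)) = 0 :=
      measure_mono_null (sdiff_subset_sdiff_right subset_closure) hvol
    have := hO.measure_eq_zero_iff volume |>.1 h0
    exact (this ▸ (⟨hy, hyc⟩ : y ∈ unitCube N \ closure (⋃ l, V l)) : y ∈ (∅ : Set (Vec N)))
  have heq (l : Fin k) : EqOn φ (fun y => (A l).mulVec y + c l)
      (closure (unitCube N) ∩ closure (V l)) := by
    refine EqOn.of_subset_closure (s := V l) (hAc l) (hφ.continuousOn.mono inter_subset_left)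
      ?_ (fun y hy => ⟨subset_closure (hV l hy), subset_closure hy⟩) inter_subset_right
    exact ((Matrix.mulVecLin (A l)).continuous_of_finiteDimensional.add
      continuous_const).continuousOn
  refine ⟨K, (convex_closure_unitCube N).lipschitzOnWith_of_eventually hφ.continuousOn
    fun x hx => ?_⟩
  -- As there are finitely many pieces, points `z` near `x` share with `x` every closed piece
  -- containing `z`.
  have hev : ∀ᶠ z in 𝓝 x, ∀ l, z ∈ closure (V l) → x ∈ closure (V l) := by
    refine eventually_all.2 fun l => ?_
    by_cases hxl : x ∈ closure (V l)
    · simp [hxl]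
    · filter_upwards [isClosed_closure.isOpen_compl.mem_nhds hxl] with z hz hz'
      exact absurd hz' hz
  filter_upwards [nhdsWithin_le_nhds hev, self_mem_nhdsWithin] with z hz hzS
  obtain ⟨l, hl⟩ := mem_iUnion.1 (hdense hzS)
  rw [heq l ⟨hzS, hl⟩, heq l ⟨hx, hz l hl⟩]
  simp only [add_sub_add_right_eq_sub, ← Matrix.mulVec_sub]
  refine ((Matrix.mulVecLin (A l)).toContinuousLinearMap.le_opNorm (z - x)).trans ?_
  gcongr
  exact_mod_cast Finset.single_le_sum
    (f := fun l => ‖(Matrix.mulVecLin (A l)).toContinuousLinearMap‖₊)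
    (fun _ _ => zero_le) (Finset.mem_univ l)

lemma IsPiecewiseAffineZero.isSobolevOneInftyZero {m N : ℕ} {φ : Vec N → Vec m}
    (hφ : IsPiecewiseAffineZero φ) : IsSobolevOneInftyZero φ (gradMatrix φ) :=
  let ⟨_, hK⟩ := hφ.exists_lipschitzOnWith
  isSobolevOneInftyZero_gradMatrix hK hφ.eq_zero

/-! ### The sawtooth -/

/-- The nonnegative `1`-periodic sawtooth vanishing on `ℤ`, with slope `t` on `(0, s)` and slope
`-s` on `(s, 1)` when `s + t = 1`. -/
noncomputable def sawtooth (s t x : ℝ) : ℝ := min (t * Int.fract x) (s * (1 - Int.fract x))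

section Sawtooth

variable {s t : ℝ}

lemma sawtooth_nonneg (hs : 0 ≤ s) (ht : 0 ≤ t) (x : ℝ) : 0 ≤ sawtooth s t x :=
  le_min (mul_nonneg ht (Int.fract_nonneg x))
    (mul_nonneg hs (sub_nonneg.2 (Int.fract_lt_one x).le))

lemma sawtooth_le_one (ht : 0 ≤ t) (hst : s + t = 1) (hs : 0 ≤ s) (x : ℝ) :
    sawtooth s t x ≤ 1 :=
  (min_le_left _ _).trans (by nlinarith [Int.fract_nonneg x, Int.fract_lt_one x])

/-- The sawtooth is the minimum of the convex wedges with vertex at the integers `j`; the wedges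
serve as upper barriers. -/
lemma sawtooth_le (hs : 0 ≤ s) (ht : 0 ≤ t) (x : ℝ) (j : ℤ) :
    sawtooth s t x ≤ max (t * (x - j)) (-(s * (x - j))) := by
  have hx := Int.floor_add_fract x
  rcases le_or_gt j ⌊x⌋ with hj | hj
  · have : (j : ℝ) ≤ ⌊x⌋ := by exact_mod_cast hj
    refine (min_le_left _ _).trans (le_max_of_le_left ?_)
    gcongr
    linarith
  · have : (⌊x⌋ : ℝ) + 1 ≤ j := by exact_mod_cast hj
    refine (min_le_right _ _).trans (le_max_of_le_right ?_)
    rw [← mul_neg]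
    gcongr
    linarith

lemma sawtooth_eq_of_fract_le (hst : s + t = 1) {x : ℝ} (hx : Int.fract x ≤ s) :
    sawtooth s t x = t * (x - ⌊x⌋) := by
  rw [sawtooth, min_eq_left]
  · rfl
  · obtain rfl : t = 1 - s := by linarith
    nlinarith

lemma sawtooth_eq_of_le_fract (hst : s + t = 1) {x : ℝ} (hx : s ≤ Int.fract x) :
    sawtooth s t x = -(s * (x - (⌊x⌋ + 1 : ℤ))) := by
  rw [sawtooth, min_eq_right]
  · rw [Int.fract]; push_cast; ring
  · obtain rfl : t = 1 - s := by linarith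
    nlinarith

lemma sawtooth_eq_zero (hs : 0 ≤ s) {x : ℝ} (hx : Int.fract x = 0) : sawtooth s t x = 0 := by
  simp [sawtooth, hx, hs]

lemma exists_sawtooth_eq (hs : 0 ≤ s) (ht : 0 ≤ t) (hst : s + t = 1) (x : ℝ) :
    ∃ j : ℤ, sawtooth s t x = max (t * (x - j)) (-(s * (x - j))) := by
  rcases le_total (Int.fract x) s with h | h
  · exact ⟨⌊x⌋, (sawtooth_le hs ht x _).antisymm (max_le (sawtooth_eq_of_fract_le hst h).ge
      (by nlinarith [sawtooth_nonneg hs ht x, Int.floor_le x]))⟩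
  · refine ⟨⌊x⌋ + 1, (sawtooth_le hs ht x _).antisymm (max_le ?_
      (sawtooth_eq_of_le_fract hst h).ge)⟩
    have := Int.lt_floor_add_one x
    push_cast
    nlinarith [sawtooth_nonneg hs ht x]

lemma lipschitzWith_sawtooth (hs : 0 ≤ s) (ht : 0 ≤ t) (hst : s + t = 1) :
    LipschitzWith 1 (sawtooth s t) := by
  refine LipschitzWith.of_le_add fun x y => ?_
  obtain ⟨j, hj⟩ := exists_sawtooth_eq hs ht hst y
  refine (sawtooth_le hs ht x j).trans ?_
  rw [hj, Real.dist_eq]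
  have h1 := le_abs_self (x - y)
  have h2 := neg_abs_le (x - y)
  have h0 := abs_nonneg (x - y)
  refine max_le ?_ ?_
  · have := le_max_left (t * (y - j)) (-(s * (y - j)))
    nlinarith
  · have := le_max_right (t * (y - j)) (-(s * (y - j)))
    nlinarith

end Sawtooth

/-! ### The truncated laminate and its gradients -/

/-- The scalar profile of an approximate laminate on the unit cube: a fine sawtooth in the direction
`n`, cut off by the distance to the boundary. -/
noncomputable def laminate {N : ℕ} (s t κ θ : ℝ) (n : Vec N) (y : Vec N) : ℝ :=
  min (κ⁻¹ * sawtooth s t (κ * (n ⬝ᵥ y) + θ)) (1 / 2 - ‖y - fun _ => 1 / 2‖)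

/-- The linear form `y ↦ n ⬝ᵥ y`. -/
noncomputable def dotForm {N : ℕ} (n : Vec N) : Vec N →L[ℝ] ℝ :=
  ∑ j, n j • ContinuousLinearMap.proj j

@[simp] lemma dotForm_apply {N : ℕ} (n y : Vec N) : dotForm n y = n ⬝ᵥ y := by
  simp [dotForm, dotProduct]

section Laminate

variable {N : ℕ} {s t κ : ℝ} (θ : ℝ) (n : Vec N)

lemma exists_lipschitzWith_laminate (hs : 0 ≤ s) (ht : 0 ≤ t) (hst : s + t = 1) :
    ∃ K, LipschitzWith K (laminate s t κ θ n) := by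
  obtain ⟨K, h1⟩ : ∃ K, LipschitzWith K fun y : Vec N =>
      κ⁻¹ * sawtooth s t (κ * (n ⬝ᵥ y) + θ) := by
    have ha : LipschitzWith ‖κ • dotForm n‖₊ fun y : Vec N => κ * (n ⬝ᵥ y) + θ :=
      LipschitzWith.of_dist_le_mul fun x y => by
        simpa [dist_eq_norm, mul_sub] using (κ • dotForm n).le_opNorm (x - y)
    exact ⟨_, (LipschitzWith.of_dist_le_mul (K := ‖κ⁻¹‖₊) (f := fun x : ℝ => κ⁻¹ * x) fun x y => by
      simp [dist_eq_norm, ← mul_sub]).comp ((lipschitzWith_sawtooth hs ht hst).comp ha)⟩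
  have h2 : LipschitzWith 1 fun y : Vec N => 1 / 2 - ‖y - fun _ => 1 / 2‖ :=
    LipschitzWith.of_le_add fun x y => by
      have := norm_sub_norm_le (y - fun _ => 1 / 2) (x - fun _ => 1 / 2)
      rw [sub_sub_sub_cancel_right] at this
      rw [dist_comm, dist_eq_norm]
      linarith
  exact ⟨_, h1.min h2⟩

lemma laminate_eq_zero_of_mem_frontier (hs : 0 ≤ s) (ht : 0 ≤ t) (hκ : 0 < κ) {y : Vec N}
    (hy : y ∈ frontier (unitCube N)) : laminate s t κ θ n y = 0 := by
  rw [unitCube_eq_ball] at hy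
  have := Metric.frontier_ball_subset_sphere hy
  rw [mem_sphere_iff_norm] at this
  rw [laminate, this, sub_self, min_eq_right]
  exact mul_nonneg (inv_nonneg.2 hκ.le) (sawtooth_nonneg hs ht _)

/-- At a point of differentiability the profile either attains its minimum `0` or is touched from
above by an affine function. In the sup norm the distance to the boundary yields only the gradients
`±e_i`, hence finitely many values. -/
lemma fderiv_laminate (hs : 0 ≤ s) (ht : 0 ≤ t) (hst : s + t = 1) (hκ : 2 < κ)
    {y : Vec N} (hy : y ∈ unitCube N) (hd : DifferentiableAt ℝ (laminate s t κ θ n) y) :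
    (fderiv ℝ (laminate s t κ θ n) y =
      if Int.fract (κ * (n ⬝ᵥ y) + θ) = 0 then 0
      else if Int.fract (κ * (n ⬝ᵥ y) + θ) ≤ s then dotForm (t • n) else dotForm (-s • n)) ∨
    (1 / 2 - ‖y - fun _ => 1 / 2‖ ≤ κ⁻¹ ∧ ∃ i,
      fderiv ℝ (laminate s t κ θ n) y = dotForm (Pi.single i 1) ∨
      fderiv ℝ (laminate s t κ θ n) y = dotForm (-Pi.single i 1)) := by
  have hκ0 : 0 < κ := by linarith
  have hd0 : 0 ≤ 1 / 2 - ‖y - fun _ => 1 / 2‖ := by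
    rw [unitCube_eq_ball, mem_ball_iff_norm] at hy
    linarith
  rcases le_total (κ⁻¹ * sawtooth s t (κ * (n ⬝ᵥ y) + θ)) (1 / 2 - ‖y - fun _ => 1 / 2‖)
    with hle | hle
  · left
    have heq : laminate s t κ θ n y = κ⁻¹ * sawtooth s t (κ * (n ⬝ᵥ y) + θ) := min_eq_left hle
    have hform (r : ℝ) (j : ℤ) : HasFDerivAt
        (fun z : Vec N => κ⁻¹ * (r * (κ * (n ⬝ᵥ z) + θ - j))) (dotForm (r • n)) y := by
      have h := ((((dotForm n).hasFDerivAt (x := y)).const_mul κ).add_const (θ - j)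
        |>.const_mul (κ⁻¹ * r))
      have e1 : (fun z : Vec N => κ⁻¹ * (r * (κ * (n ⬝ᵥ z) + θ - j))) =
          fun z => κ⁻¹ * r * (κ * dotForm n z + (θ - j)) := by
        funext z; simp only [dotForm_apply]; ring
      have e2 : dotForm (r • n) = (κ⁻¹ * r) • κ • dotForm n := by
        ext1 z; simp; field_simp
      rw [e1, e2]; exact h
    have hub (z : Vec N) (j : ℤ) : laminate s t κ θ n z ≤
        κ⁻¹ * max (t * (κ * (n ⬝ᵥ z) + θ - j)) (-(s * (κ * (n ⬝ᵥ z) + θ - j))) :=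
      (min_le_left _ _).trans (by gcongr; exact sawtooth_le hs ht _ j)
    have hcont : ContinuousAt (fun z : Vec N => κ * (n ⬝ᵥ z) + θ) y := by fun_prop
    have hfl := Int.floor_add_fract (κ * (n ⬝ᵥ y) + θ)
    have hlt := Int.fract_lt_one (κ * (n ⬝ᵥ y) + θ)
    split_ifs with h1 h2
    · refine IsLocalMin.fderiv_eq_zero ?_
      rw [sawtooth_eq_zero hs h1, mul_zero] at heq
      filter_upwards [(isOpen_unitCube N).mem_nhds hy] with z hz
      rw [heq]
      rw [unitCube_eq_ball, mem_ball_iff_norm] at hz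
      exact le_min (mul_nonneg (inv_nonneg.2 hκ0.le) (sawtooth_nonneg hs ht _)) (by linarith)
    · refine fderiv_eq_of_touching hd (hform t ⌊κ * (n ⬝ᵥ y) + θ⌋) ?_
        (heq.trans (by rw [sawtooth_eq_of_fract_le hst h2]))
      have hpos : 0 < Int.fract (κ * (n ⬝ᵥ y) + θ) := (Int.fract_nonneg _).lt_of_ne' h1
      filter_upwards [hcont.eventually_const_lt
        (show (⌊κ * (n ⬝ᵥ y) + θ⌋ : ℝ) < κ * (n ⬝ᵥ y) + θ by linarith)] with z hz
      refine (hub z ⌊κ * (n ⬝ᵥ y) + θ⌋).trans (le_of_eq ?_)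
      rw [max_eq_left]
      nlinarith
    · refine fderiv_eq_of_touching hd (hform (-s) (⌊κ * (n ⬝ᵥ y) + θ⌋ + 1)) ?_
        (heq.trans (by rw [sawtooth_eq_of_le_fract hst (not_le.1 h2).le]; ring))
      filter_upwards [hcont.eventually_lt_const
        (show κ * (n ⬝ᵥ y) + θ < ((⌊κ * (n ⬝ᵥ y) + θ⌋ + 1 : ℤ) : ℝ) by push_cast; linarith)]
        with z hz
      refine (hub z (⌊κ * (n ⬝ᵥ y) + θ⌋ + 1)).trans (le_of_eq ?_)
      rw [max_eq_right, neg_mul]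
      nlinarith
  · right
    have hd1 : 1 / 2 - ‖y - fun _ => 1 / 2‖ ≤ κ⁻¹ :=
      hle.trans (mul_le_of_le_one_right (inv_nonneg.2 hκ0.le) (sawtooth_le_one ht hst hs _))
    -- This keeps the layer away from the centre of the cube, so the maximal coordinate of `y - 1/2`
    -- is nonzero and has a definite sign.
    have hκinv : κ⁻¹ < 1 / 2 := by
      rw [one_div]; exact inv_strictAnti₀ two_pos hκ
    obtain ⟨i, hi⟩ : ∃ i, ‖y - fun _ => 1 / 2‖ ≤ ‖(y - fun _ => 1 / 2 : Vec N) i‖ := by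
      by_contra! hcon
      exact lt_irrefl _ ((pi_norm_lt_iff (by linarith)).2 hcon)
    have hi' := hi.antisymm' (norm_le_pi_norm _ i)
    have heq : laminate s t κ θ n y = 1 / 2 - ‖y - fun _ => 1 / 2‖ := min_eq_right hle
    have hub (z : Vec N) : laminate s t κ θ n z ≤ 1 / 2 - |z i - 1 / 2| :=
      (min_le_right _ _).trans
        (sub_le_sub_left (norm_le_pi_norm (z - fun _ => (1 / 2 : ℝ)) i) _)
    rw [← hi', Pi.sub_apply, Real.norm_eq_abs] at heq hd1
    have hproj (r : ℝ) (v : Vec N) (hv : ∀ z : Vec N, v ⬝ᵥ z = r * z i) (b : ℝ) :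
        HasFDerivAt (fun z : Vec N => r * z i + b) (dotForm v) y := by
      simp_rw [← hv, ← dotForm_apply]
      exact (dotForm v).hasFDerivAt.add_const b
    refine ⟨by rwa [← hi', Pi.sub_apply, Real.norm_eq_abs], i, ?_⟩
    rcases lt_or_gt_of_ne (show y i - 1 / 2 ≠ 0 by
      intro h; rw [h, abs_zero] at hd1; linarith) with h | h
    · left
      refine fderiv_eq_of_touching hd (hproj 1 _ (by simp) 0)
        (Eventually.of_forall fun z => (hub z).trans ?_) (heq.trans ?_)
      · linarith [neg_abs_le (z i - 1 / 2)]
      · rw [abs_of_neg h]; ring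
    · right
      refine fderiv_eq_of_touching hd (hproj (-1) _ (by simp) 1)
        (Eventually.of_forall fun z => (hub z).trans ?_) (heq.trans ?_)
      · linarith [le_abs_self (z i - 1 / 2)]
      · rw [abs_of_pos h]; ring

end Laminate

/-! ### Averaging over the phase, and the boundary layer -/

/-- The `1`-periodic function with value `c` on `ℤ`, `a` on `(0, s]` and `b` on `(s, 1)`. -/
noncomputable def phase (s : ℝ) (a b c : ℝ≥0∞) (x : ℝ) : ℝ≥0∞ :=
  if Int.fract x = 0 then c else if Int.fract x ≤ s then a else b

lemma measurable_phase (s : ℝ) (a b c : ℝ≥0∞) : Measurable (phase s a b c) :=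
  Measurable.ite (measurable_fract (measurableSet_singleton 0)) measurable_const
    (Measurable.ite (measurable_fract measurableSet_Iic) measurable_const measurable_const)

lemma periodic_phase (s : ℝ) (a b c : ℝ≥0∞) : Function.Periodic (phase s a b c) 1 := fun x => by
  simp [phase]

/-- Periodicity removes the shift `x`, and the value `c` is taken only on a null set of phases. -/
lemma lintegral_phase_le {s t : ℝ≥0} (hst : s + t = 1) (a b c : ℝ≥0∞) (x : ℝ) :
    ∫⁻ θ in Ioc (0 : ℝ) 1, phase s a b c (x + θ) ≤ s * a + t * b := by
  have hshift : ∫⁻ θ in Ioc (0 : ℝ) 1, phase s a b c (x + θ) =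
      ∫⁻ θ in Ioc (0 : ℝ) 1, phase s a b c θ := by
    have h1 := (measurePreserving_add_left (volume : Measure ℝ) x).setLIntegral_comp_preimage_emb
      (measurableEmbedding_addLeft x) (phase s a b c) (Ioc x (x + 1))
    have h2 := UnitAddCircle.lintegral_preimage x (periodic_phase s a b c).lift
    have h3 := UnitAddCircle.lintegral_preimage 0 (periodic_phase s a b c).lift
    simp only [Function.Periodic.lift_coe, zero_add] at h2 h3
    rw [preimage_const_add_Ioc, sub_self, add_sub_cancel_left] at h1
    rw [h1, h2, h3]
  rw [hshift, ← restrict_Ioo_eq_restrict_Ioc]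
  calc ∫⁻ θ in Ioo (0 : ℝ) 1, phase s a b c θ
      ≤ ∫⁻ θ in Ioo (0 : ℝ) 1, ((Ioc 0 (s : ℝ)).indicator (fun _ => a) θ +
          (Ioo (s : ℝ) 1).indicator (fun _ => b) θ) := by
        refine setLIntegral_mono' measurableSet_Ioo fun θ hθ => ?_
        have hf : Int.fract θ = θ := Int.fract_eq_self.2 ⟨hθ.1.le, hθ.2⟩
        rw [phase, hf, if_neg hθ.1.ne']
        split_ifs with h
        · rw [indicator_of_mem (show θ ∈ Ioc 0 (s : ℝ) from ⟨hθ.1, h⟩)]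
          exact le_self_add
        · rw [indicator_of_mem (show θ ∈ Ioo (s : ℝ) 1 from ⟨not_le.1 h, hθ.2⟩)]
          exact le_add_self
    _ ≤ ∫⁻ θ, ((Ioc 0 (s : ℝ)).indicator (fun _ => a) θ +
          (Ioo (s : ℝ) 1).indicator (fun _ => b) θ) := setLIntegral_le_lintegral _ _
    _ = s * a + t * b := by
        rw [lintegral_add_left (measurable_const.indicator measurableSet_Ioc),
          lintegral_indicator_const measurableSet_Ioc, lintegral_indicator_const measurableSet_Ioo,
          Real.volume_Ioc, Real.volume_Ioo]
        have ht : (1 : ℝ) - s = t := by rw [← NNReal.coe_one, ← hst]; push_cast; ring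
        rw [sub_zero, ht, ENNReal.ofReal_coe_nnreal, ENNReal.ofReal_coe_nnreal, mul_comm a,
          mul_comm b]

/-- The points of the unit cube at distance at most `r` from its boundary. -/
def boundaryLayer (N : ℕ) (r : ℝ) : Set (Vec N) :=
  {y | y ∈ unitCube N ∧ 1 / 2 - ‖y - fun _ => 1 / 2‖ ≤ r}

lemma measurableSet_boundaryLayer (N : ℕ) (r : ℝ) : MeasurableSet (boundaryLayer N r) :=
  (isOpen_unitCube N).measurableSet.inter
    (measurableSet_le (f := fun y : Vec N => 1 / 2 - ‖y - fun _ => 1 / 2‖)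
      (Continuous.measurable (by fun_prop)) measurable_const)

/-- The layers decrease to the empty set because the cube is open. The offset `3` keeps the
frequency above `2`, as `fderiv_laminate` requires. -/
lemma tendsto_volume_boundaryLayer (N : ℕ) :
    Tendsto (fun k : ℕ => volume (boundaryLayer N ((k : ℝ) + 3)⁻¹)) atTop (𝓝 0) := by
  have hlim : Tendsto (fun k : ℕ => ((k : ℝ) + 3)⁻¹) atTop (𝓝 0) :=
    (tendsto_natCast_atTop_atTop.atTop_add tendsto_const_nhds).inv_tendsto_atTop
  have h := tendsto_measure_iInter_atTop (μ := volume)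
    (s := fun k : ℕ => boundaryLayer N ((k : ℝ) + 3)⁻¹)
    (fun k => (measurableSet_boundaryLayer N _).nullMeasurableSet)
    (fun k l hkl y hy => ⟨hy.1, hy.2.trans (by gcongr)⟩)
    ⟨0, ne_top_of_le_ne_top (by simp [volume_unitCube])
      (measure_mono (show boundaryLayer N _ ⊆ unitCube N from fun y hy => hy.1))⟩
  have hempty : ⋂ k : ℕ, boundaryLayer N ((k : ℝ) + 3)⁻¹ = ∅ := by
    refine eq_empty_of_forall_notMem fun y hy => ?_
    rw [mem_iInter] at hy
    have h1 := ge_of_tendsto' hlim fun k => (hy k).2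
    have h2 := (hy 0).1
    rw [unitCube_eq_ball, mem_ball_iff_norm] at h2
    linarith
  rwa [hempty, measure_empty] at h

/-! ### Rank-one convexity of finite quasiconvex functions -/

lemma gradMatrix_mul {m N : ℕ} {h : Vec N → ℝ} {y : Vec N} (hh : DifferentiableAt ℝ h y)
    (a : Vec m) {v : Vec N} (hv : fderiv ℝ h y = dotForm v) :
    gradMatrix (fun z i => a i * h z) y = Matrix.of fun i j => a i * v j := by
  ext i j
  have hd : HasFDerivAt (fun z i => a i * h z)
      (ContinuousLinearMap.pi fun i => a i • dotForm v) y :=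
    hasFDerivAt_pi.2 fun i => (hv ▸ hh.hasFDerivAt).const_mul (a i)
  simp [gradMatrix, hd.fderiv]

/-- A finite quasiconvex function is rank-one convex. -/
theorem IsQuasiconvex.isRankOneConvex {m N : ℕ} {V : Mat m N → ℝ≥0∞} (hV : IsQuasiconvex V)
    (hfin : ∀ F, V F ≠ ⊤) : IsRankOneConvex V := by
  intro A B hAB s t hst
  obtain ⟨a, n, han⟩ := exists_eq_mul_of_rank_le_one hAB
  have hs : (0 : ℝ) ≤ s := s.2
  have ht : (0 : ℝ) ≤ t := t.2
  have hst' : (s : ℝ) + t = 1 := by exact_mod_cast hst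
  set F : Mat m N := (s : ℝ) • A + (t : ℝ) • B with hF
  have hFA : F + Matrix.of (fun i j => a i * ((t : ℝ) • n) j) = A := by
    ext i j
    have := han i j
    simp only [Matrix.sub_apply] at this
    simp only [hF, Matrix.add_apply, Matrix.smul_apply, Matrix.of_apply, Pi.smul_apply, smul_eq_mul]
    linear_combination (A i j) * hst' - (t : ℝ) * this
  have hFB : F + Matrix.of (fun i j => a i * (-(s : ℝ) • n) j) = B := by
    ext i j
    have := han i j
    simp only [Matrix.sub_apply] at this
    simp only [hF, Matrix.add_apply, Matrix.smul_apply, Matrix.of_apply, Pi.smul_apply, smul_eq_mul]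
    linear_combination (B i j) * hst' + (s : ℝ) * this
  let e (v : Vec N) : ℝ≥0∞ := V (F + Matrix.of fun i j => a i * v j)
  -- A sum over all possible layer gradients replaces local boundedness of `V`; finiteness of `V`
  -- alone makes it finite.
  let M : ℝ≥0∞ := ∑ i, (e (Pi.single i 1) + e (-Pi.single i 1))
  have hM : M ≠ ⊤ := ENNReal.sum_ne_top.2 fun i _ => ENNReal.add_ne_top.2 ⟨hfin _, hfin _⟩
  have hbound (k : ℕ) :
      V F ≤ s * V A + t * V B + M * volume (boundaryLayer N ((k : ℝ) + 3)⁻¹) := by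
    set κ : ℝ := (k : ℝ) + 3 with hκ
    have hκ2 : 2 < κ := by linarith [Nat.cast_nonneg (α := ℝ) k]
    -- An explicit majorant of `V (F + ∇φ)`, jointly measurable in `(θ, y)` so that Tonelli applies.
    let f (θ : ℝ) (y : Vec N) : ℝ≥0∞ := phase s (V A) (V B) (V F) (κ * (n ⬝ᵥ y) + θ) +
      (boundaryLayer N κ⁻¹).indicator (fun _ => M) y
    have hfm : Measurable (Function.uncurry f) := by
      refine Measurable.add ((measurable_phase _ _ _ _).comp ?_)
        ((measurable_const.indicator (measurableSet_boundaryLayer N _)).comp measurable_snd)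
      exact (Continuous.measurable (by fun_prop))
    have hθ (θ : ℝ) : V F ≤ ∫⁻ y in unitCube N, f θ y := by
      obtain ⟨K, hK⟩ := exists_lipschitzWith_laminate (κ := κ) θ n hs ht hst'
      have hφ : LipschitzWith (‖a‖₊ * K) fun z i => a i * laminate s t κ θ n z :=
        LipschitzWith.of_dist_le_mul fun x y => by
          refine (dist_pi_le_iff (by positivity)).2 fun i => ?_
          rw [dist_eq_norm, ← mul_sub, norm_mul, NNReal.coe_mul, mul_assoc, coe_nnnorm]
          exact mul_le_mul (norm_le_pi_norm a i) (by simpa [dist_eq_norm] using hK.dist_le_mul x y)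
            (norm_nonneg _) (norm_nonneg _)
      refine (hV.le_lintegral F _ _ (isSobolevOneInftyZero_gradMatrix hφ.lipschitzOnWith
        fun y hy => ?_)).trans (lintegral_mono_ae ?_)
      · funext i
        simp [laminate_eq_zero_of_mem_frontier θ n hs ht (by linarith : 0 < κ) hy]
      · filter_upwards [ae_restrict_mem (isOpen_unitCube N).measurableSet,
          ae_restrict_of_ae (hK.ae_differentiableAt (μ := volume))] with y hy hd
        rcases fderiv_laminate θ n hs ht hst' hκ2 hy hd with h | ⟨hlayer, i, h⟩
        · refine le_add_right ?_
          rw [phase]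
          split_ifs at h ⊢
          · have h0 : fderiv ℝ (laminate s t κ θ n) y = dotForm 0 := by rw [h]; ext; simp
            rw [gradMatrix_mul hd a h0]
            refine le_of_eq (congrArg V ?_)
            ext; simp
          · rw [gradMatrix_mul hd a h, hFA]
          · rw [gradMatrix_mul hd a h, hFB]
        · refine le_add_left ?_
          rw [indicator_of_mem (show y ∈ boundaryLayer N κ⁻¹ from ⟨hy, hlayer⟩)]
          refine le_trans ?_ (Finset.single_le_sum
            (f := fun i => e (Pi.single i 1) + e (-Pi.single i 1)) (fun _ _ => zero_le)
            (Finset.mem_univ i))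
          rcases h with h | h
          · rw [gradMatrix_mul hd a h]; exact le_self_add
          · rw [gradMatrix_mul hd a h]; exact le_add_self
    -- Averaging over `θ` first makes the weights exact for every `y`, so no limit is needed in the
    -- oscillating term.
    calc V F = ∫⁻ _ in Ioc (0 : ℝ) 1, V F := by simp
      _ ≤ ∫⁻ θ in Ioc (0 : ℝ) 1, ∫⁻ y in unitCube N, f θ y := lintegral_mono hθ
      _ = ∫⁻ y in unitCube N, ∫⁻ θ in Ioc (0 : ℝ) 1, f θ y :=
          lintegral_lintegral_swap hfm.aemeasurable
      _ ≤ ∫⁻ y in unitCube N, (s * V A + t * V B +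
            (boundaryLayer N κ⁻¹).indicator (fun _ => M) y) := by
          refine lintegral_mono fun y => ?_
          simp only [f]
          rw [lintegral_add_right _ measurable_const]
          refine add_le_add (lintegral_phase_le hst _ _ _ _) (by simp)
      _ ≤ s * V A + t * V B + M * volume (boundaryLayer N κ⁻¹) := by
          rw [lintegral_add_left measurable_const, setLIntegral_const, volume_unitCube, mul_one]
          gcongr
          refine (setLIntegral_le_lintegral _ _).trans_eq ?_
          exact lintegral_indicator_const (measurableSet_boundaryLayer N _) M
  have hlim := (ENNReal.Tendsto.const_mul (tendsto_volume_boundaryLayer N)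
    (Or.inr hM)).const_add (s * V A + t * V B)
  rw [mul_zero, add_zero] at hlim
  exact ge_of_tendsto' hlim hbound

/-! ### Comparison of the envelopes -/

lemma IsQuasiconvex.le_zInfty {m N : ℕ} {V W : Mat m N → ℝ≥0∞} (hV : IsQuasiconvex V)
    (hVW : ∀ F, V F ≤ W F) (F : Mat m N) : V F ≤ zInfty W F :=
  le_iInf fun φ => le_iInf fun G => le_iInf fun hφ =>
    (hV.le_lintegral F φ G hφ).trans (lintegral_mono fun _ => hVW _)

lemma IsQuasiconvex.le_zAff {m N : ℕ} {V W : Mat m N → ℝ≥0∞} (hV : IsQuasiconvex V)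
    (hVW : ∀ F, V F ≤ W F) (F : Mat m N) : V F ≤ zAff W F :=
  le_iInf fun φ => le_iInf fun hφ =>
    (hV.le_lintegral F φ _ hφ.isSobolevOneInftyZero).trans (lintegral_mono fun _ => hVW _)

lemma rankOneConvexEnvelope_le {m N : ℕ} (W : Mat m N → ℝ≥0∞) (F : Mat m N) :
    rankOneConvexEnvelope W F ≤ W F :=
  iSup_le fun _ => iSup_le fun _ => iSup_le fun hVW => hVW F

end QuasiconvexEnvelope

theorem mainTheorem4 (m N : ℕ)
    (W : QuasiconvexEnvelope.Mat m N → ENNReal) (hW : Measurable W)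
    (hfin : (∀ F, QuasiconvexEnvelope.zInfty W F < ⊤) ∨
      (∀ F, QuasiconvexEnvelope.zAff W F < ⊤)) :
    QuasiconvexEnvelope.quasiconvexEnvelope (QuasiconvexEnvelope.rankOneConvexEnvelope W) =
      QuasiconvexEnvelope.quasiconvexEnvelope W := by
  funext F
  refine le_antisymm (iSup_le fun V => iSup_le fun hV => iSup_le fun hVW => ?_)
    (iSup_le fun V => iSup_le fun hV => iSup_le fun hVW => ?_)
  · exact le_iSup_of_le V (le_iSup_of_le hV (le_iSup_of_le (fun F' => (hVW F').trans
      (QuasiconvexEnvelope.rankOneConvexEnvelope_le W F')) le_rfl))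
  · have hVfin (F') : V F' ≠ ⊤ := by
      rcases hfin with h | h
      · exact ((hV.le_zInfty hVW F').trans_lt (h F')).ne
      · exact ((hV.le_zAff hVW F').trans_lt (h F')).ne
    exact le_iSup_of_le V (le_iSup_of_le hV (le_iSup_of_le (fun F' => le_iSup_of_le V
      (le_iSup_of_le (hV.isRankOneConvex hVfin) (le_iSup_of_le hVW le_rfl))) le_rfl))
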